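/- Let $X,Y$ be finite nonempty sets and $f:X\times Y\to\{0,1\}$. A realization of $f$ with margin $\gamma>0$ (by homogeneous halfspaces) is an assignment of unit vectors $\alpha_x,\beta_y\in\mathbb R^d$ ($x\in X$, $y\in Y$), for some finite $d$, such that $\langle\alpha_x,\beta_y\rangle\ge\gamma$ whenever $f(x,y)=0$ and $\langle\alpha_x,\beta_y\rangle\le-\gamma$ whenever $f(x,y)=1$; equivalently, $M_{xy}\langle\alpha_x,\beta_y\rangle\ge\gamma$ for all $x,y$, where $M_{xy}=(-1)^{f(x,y)}$. A repeated fingerprinting protocol for $f$ with $r\ge1$ copies of $q$-qubit states consists of unit vectors $|\alpha_x\rangle,|\beta_y\rangle\in\mathbb R^{2^q}$ ($q$-qubit pure states with real amplitudes) for which there are thresholds $\delta_0<\delta_1$ with $|\langle\alpha_x|\beta_y\rangle|^2\le\delta_0$ whenever $f(x,y)=0$ and $|\langle\alpha_x|\beta_y\rangle|^2\ge\delta_1$ whenever $f(x,y)=1$, together with a (possibly randomized) referee who, on input $(x,y)$, sees the outcome bits of $r$ independent swap tests, each equal to $0$ with probability $\frac12+\frac12|\langle\alpha_x|\beta_y\rangle|^2$,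 and from these $r$ bits outputs $f(x,y)$ with probability at least $2/3$, for every $(x,y)$. Then there are absolute constants $C,c>0$ such that for all finite nonempty $X,Y$, every integer $n\ge2$ with $|X|,|Y|\le2^n$ (inputs are encoded by $n$ bits), and every $f:X\times Y\to\{0,1\}$: 1. among the margins of all realizations of $f$ (of any dimension) there is a largest one, $\gamma$; 2. there is a repeated fingerprinting protocol for $f$, with a deterministic referee, that uses $r\le C/\gamma^2$ copies of $q$-qubit states with $q\le C\log_2(n/\gamma)$; 3. every repeated fingerprinting protocol for $f$ uses $r\ge c/\gamma^2$ copies, whatever the number of qubits of its states. -/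

import Mathlib

noncomputable section

/-- An assignment of unit vectors `α x`, `β y` in `ℝ^ι` is a realization of `f` (by homogeneous
halfspaces) with margin `γ > 0`: `⟨α x, β y⟩ ≥ γ` if `f x y = 0` and `⟨α x, β y⟩ ≤ -γ` if
`f x y = 1`. The values `0`, `1` of `f` are `false`, `true`. -/
structure IsRealization {X Y ι : Type*} [Fintype ι] (f : X → Y → Bool)
    (α : X → EuclideanSpace ℝ ι) (β : Y → EuclideanSpace ℝ ι) (γ : ℝ) : Prop where
  norm_left : ∀ x, ‖α x‖ = 1
  norm_right : ∀ y, ‖β y‖ = 1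
  pos : 0 < γ
  le_inner : ∀ x y, f x y = false → γ ≤ inner ℝ (α x) (β y)
  inner_le : ∀ x y, f x y = true → inner ℝ (α x) (β y) ≤ -γ

/-- The margins achieved by realizations of `f`, of any finite dimension `d`. -/
def marginSet {X Y : Type*} (f : X → Y → Bool) : Set ℝ :=
  {γ | ∃ (d : ℕ) (α : X → EuclideanSpace ℝ (Fin d)) (β : Y → EuclideanSpace ℝ (Fin d)),
    IsRealization f α β γ}

/-- The largest margin among all realizations of `f`. -/
def maxMargin {X Y : Type*} (f : X → Y → Bool) : ℝ :=
  sSup (marginSet f)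

/-- An assignment of unit vectors in `ℝ^ι` is a threshold embedding of `f` with thresholds
`δ₀`, `δ₁`. -/
structure IsThresholdEmbedding {X Y ι : Type*} [Fintype ι] (f : X → Y → Bool)
    (α : X → EuclideanSpace ℝ ι) (β : Y → EuclideanSpace ℝ ι) (δ₀ δ₁ : ℝ) : Prop where
  norm_left : ∀ x, ‖α x‖ = 1
  norm_right : ∀ y, ‖β y‖ = 1
  inner_sq_le : ∀ x y, f x y = false → |inner ℝ (α x) (β y)| ^ 2 ≤ δ₀
  le_inner_sq : ∀ x y, f x y = true → δ₁ ≤ |inner ℝ (α x) (β y)| ^ 2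

/-- A (real) `q`-qubit amplitude vector, indexed by the classical `q`-bit states. -/
abbrev QubitVector (q : ℕ) : Type := EuclideanSpace ℝ (Fin q → Bool)

/-- The probability that the swap test on the pure states `a`, `b` has outcome `z`:
outcome `0` has probability `1/2 + |⟨a, b⟩|²/2`. -/
def swapTestProb {q : ℕ} (a b : QubitVector q) (z : Bool) : ℝ :=
  if z = false then 1 / 2 + |inner ℝ a b| ^ 2 / 2 else 1 / 2 - |inner ℝ a b| ^ 2 / 2

/-- Alice sends `r ≥ 1` copies of the `q`-qubit state `alice x`, Bob sends `r` copies of the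
`q`-qubit state `bob y`; the referee performs `r` swap tests and, on the outcomes
`z : Fin r → Bool`, outputs `1` with probability `referee z`. -/
structure SwapTestProtocol (X Y : Type*) (q r : ℕ) where
  alice : X → QubitVector q
  bob : Y → QubitVector q
  norm_alice : ∀ x, ‖alice x‖ = 1
  norm_bob : ∀ y, ‖bob y‖ = 1
  one_le_copies : 1 ≤ r
  referee : (Fin r → Bool) → ℝ
  referee_mem : ∀ z, referee z ∈ Set.Icc (0 : ℝ) 1

namespace SwapTestProtocol

variable {X Y : Type*} {q r : ℕ}

/-- The referee's output is a function of the `r` outcomes, without coin flips. -/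
def Deterministic (P : SwapTestProtocol X Y q r) : Prop :=
  ∀ z, P.referee z = 0 ∨ P.referee z = 1

/-- The probability that the referee outputs `1` on input `(x, y)`; the `r` swap tests are
independent. -/
def outputOneProb (P : SwapTestProtocol X Y q r) (x : X) (y : Y) : ℝ :=
  ∑ z : Fin r → Bool, (∏ i, swapTestProb (P.alice x) (P.bob y) (z i)) * P.referee z

/-- `P` is a repeated fingerprinting protocol for `f`: its states separate the `0`-inputs from
the `1`-inputs of `f` by the size of the squared inner product (for some thresholds `δ₀ < δ₁`),
and the referee errs with probability at most `1/3` on every input. -/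
structure IsRepeatedFingerprintingFor (P : SwapTestProtocol X Y q r) (f : X → Y → Bool) :
    Prop where
  threshold : ∃ δ₀ δ₁ : ℝ, δ₀ < δ₁ ∧ IsThresholdEmbedding f P.alice P.bob δ₀ δ₁
  correct_zero : ∀ x y, f x y = false → P.outputOneProb x y ≤ 1 / 3
  correct_one : ∀ x y, f x y = true → 2 / 3 ≤ P.outputOneProb x y

end SwapTestProtocol

end

/-! A largest margin exists by compactness: the Gram matrix of a realization lets it be moved into
dimension `|X| + |Y|`, where the smallest signed inner product is a continuous function on a product
of spheres (`isGreatest_maxMargin`).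

Upper bound on the resources: a random sign projection of Johnson–Lindenstrauss type brings an
optimal realization down to dimension `O(n/γ²)` while keeping a third of the margin
(`IsRealization.exists_fin`). The states `(1, α)/√2` and `(1, -β)/√2` have inner product `(1 - ⟨α,
β⟩)/2 ≥ 0`, so the swap-test probabilities of 0-inputs and 1-inputs differ by at least a constant
times `γ`. Comparing the number of outcomes `0` with a threshold then succeeds after `O(1/γ²)`
tests, by a Chernoff bound (`IsRealization.exists_protocol`).

Lower bound on `r`: let `δ₀ < δ₁` be the extreme squared inner products on 0-inputs and 1-inputs. A
`χ²` estimate gives `r (δ₁ - δ₀)² / (1 - δ₀) ≥ 1/4` (`quarter_le_copies_mul`). Turning the states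
directly into a realization gives only a margin of order `δ₁ - δ₀`, too little when `δ₀` is near
`1`. Taking tensor powers of order `1/(1 - δ₀)` first raises this to order `(δ₁ - δ₀)/(1 - δ₀)`
(`IsThresholdEmbedding.exists_mem_marginSet`), and the two estimates combine to `r ≥ c/γ²`. -/

/-- The sign `(-1)^b` of a bit. -/
def bitSign (b : Bool) : ℝ := if b then -1 else 1

theorem abs_bitSign (b : Bool) : |bitSign b| = 1 := by
  cases b <;> simp [bitSign]

theorem bitSign_mul_self (b : Bool) : bitSign b * bitSign b = 1 := by
  cases b <;> simp [bitSign]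

/-! ### Realizations and the existence of a largest margin. -/

section Realization

variable {X Y ι κ : Type*} [Fintype ι] [Fintype κ] {f : X → Y → Bool}

theorem isRealization_iff_bitSign {α : X → EuclideanSpace ℝ ι} {β : Y → EuclideanSpace ℝ ι}
    {γ : ℝ} :
    IsRealization f α β γ ↔ (∀ x, ‖α x‖ = 1) ∧ (∀ y, ‖β y‖ = 1) ∧ 0 < γ ∧
      ∀ x y, γ ≤ bitSign (f x y) * inner ℝ (α x) (β y) := by
  constructor
  · intro h
    refine ⟨h.norm_left, h.norm_right, h.pos, fun x y => ?_⟩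
    cases hf : f x y
    · simpa [bitSign] using h.le_inner x y hf
    · have := h.inner_le x y hf
      simp only [bitSign, if_true]
      linarith
  · rintro ⟨h1, h2, h3, h4⟩
    refine ⟨h1, h2, h3, fun x y hf => ?_, fun x y hf => ?_⟩
    · simpa [bitSign, hf] using h4 x y
    · have := h4 x y
      simp only [bitSign, hf, if_true] at this
      linarith

/-- Realizability depends only on the inner products of the vectors. -/
theorem IsRealization.of_inner_eq {α : X → EuclideanSpace ℝ ι} {β : Y → EuclideanSpace ℝ ι}
    {γ : ℝ} (h : IsRealization f α β γ) {α' : X → EuclideanSpace ℝ κ}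
    {β' : Y → EuclideanSpace ℝ κ} (hα : ∀ x, ‖α' x‖ = ‖α x‖) (hβ : ∀ y, ‖β' y‖ = ‖β y‖)
    (hαβ : ∀ x y, inner ℝ (α' x) (β' y) = inner ℝ (α x) (β y)) : IsRealization f α' β' γ where
  norm_left x := by rw [hα, h.norm_left]
  norm_right y := by rw [hβ, h.norm_right]
  pos := h.pos
  le_inner x y hf := by rw [hαβ]; exact h.le_inner x y hf
  inner_le x y hf := by rw [hαβ]; exact h.inner_le x y hf

theorem IsRealization.mem_marginSet {α : X → EuclideanSpace ℝ ι} {β : Y → EuclideanSpace ℝ ι}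
    {γ : ℝ} (h : IsRealization f α β γ) : γ ∈ marginSet f := by
  let e := LinearIsometryEquiv.piLpCongrLeft 2 ℝ ℝ (Fintype.equivFin ι)
  exact ⟨Fintype.card ι, fun x => e (α x), fun y => e (β y),
    h.of_inner_eq (fun x => e.norm_map _) (fun y => e.norm_map _)
      (fun x y => e.inner_map_map _ _)⟩

theorem IsRealization.le_one [Nonempty X] [Nonempty Y] {α : X → EuclideanSpace ℝ ι}
    {β : Y → EuclideanSpace ℝ ι} {γ : ℝ} (h : IsRealization f α β γ) : γ ≤ 1 := by
  obtain ⟨h1, h2, -, h4⟩ := isRealization_iff_bitSign.1 h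
  obtain ⟨x⟩ := ‹Nonempty X›
  obtain ⟨y⟩ := ‹Nonempty Y›
  refine (h4 x y).trans ((le_abs_self _).trans ?_)
  rw [abs_mul, abs_bitSign, one_mul]
  simpa [h1, h2] using abs_real_inner_le_norm (α x) (β y)

open scoped MatrixOrder Matrix.Norms.L2Operator in
/-- Finitely many vectors of a Euclidean space have an isometric copy in the Euclidean space
indexed by themselves. -/
theorem exists_inner_eq_of_finite {I : Type*} [Fintype I] (v : I → EuclideanSpace ℝ ι) :
    ∃ w : I → EuclideanSpace ℝ I, ∀ i j, inner ℝ (w i) (w j) = inner ℝ (v i) (v j) := by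
  classical
  -- The Gram matrix is positive semidefinite, hence of the form `Bᵀ B`; the columns of `B` are the
  -- required vectors.
  obtain ⟨B, hB⟩ := CStarAlgebra.nonneg_iff_eq_star_mul_self.1 (Matrix.posSemidef_gram ℝ v).nonneg
  refine ⟨fun i => WithLp.toLp 2 fun k => B k i, fun i j => ?_⟩
  have := congrFun (congrFun hB i) j
  rw [Matrix.gram_apply] at this
  rw [this, Matrix.star_eq_conjTranspose, Matrix.mul_apply, PiLp.inner_apply]
  refine Finset.sum_congr rfl fun k _ => ?_
  simp [mul_comm]

theorem IsRealization.exists_sum [Fintype X] [Fintype Y] {α : X → EuclideanSpace ℝ ι}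
    {β : Y → EuclideanSpace ℝ ι} {γ : ℝ} (h : IsRealization f α β γ) :
    ∃ (α' : X → EuclideanSpace ℝ (X ⊕ Y)) (β' : Y → EuclideanSpace ℝ (X ⊕ Y)),
      IsRealization f α' β' γ := by
  obtain ⟨w, hw⟩ := exists_inner_eq_of_finite (Sum.elim α β)
  have hn : ∀ i, ‖w i‖ = ‖Sum.elim α β i‖ := fun i => by
    rw [norm_eq_sqrt_real_inner, norm_eq_sqrt_real_inner, hw]
  exact ⟨fun x => w (.inl x), fun y => w (.inr y),
    h.of_inner_eq (fun x => hn (.inl x)) (fun y => hn (.inr y)) fun x y => hw (.inl x) (.inr y)⟩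

/-- Standard basis vectors for `X` and normalized sign columns of `f` for `Y` give margin `1/√|X|`.
-/
theorem marginSet_nonempty [Fintype X] [Nonempty X] (f : X → Y → Bool) :
    (marginSet f).Nonempty := by
  classical
  have hX : (0 : ℝ) < Fintype.card X := by exact_mod_cast Fintype.card_pos
  set s : ℝ := (√(Fintype.card X : ℝ))⁻¹ with hs
  have hs0 : 0 < s := by positivity
  refine ⟨s, IsRealization.mem_marginSet (ι := X) (α := fun x => EuclideanSpace.single x 1)
    (β := fun y => WithLp.toLp 2 fun x => s * bitSign (f x y)) ?_⟩
  refine isRealization_iff_bitSign.2 ⟨fun x => by simp, fun y => ?_, hs0, fun x y => ?_⟩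
  · rw [EuclideanSpace.norm_eq]
    have : ∀ x, ‖s * bitSign (f x y)‖ ^ 2 = (Fintype.card X : ℝ)⁻¹ := fun x => by
      rw [Real.norm_eq_abs, abs_mul, abs_bitSign, mul_one, sq_abs, hs, inv_pow,
        Real.sq_sqrt hX.le]
    simp only [this]
    simp [hX.ne']
  · simp only [EuclideanSpace.inner_single_left]
    simp only [map_one, one_mul]
    rw [mul_left_comm, bitSign_mul_self, mul_one]

/-- `IsRealization.exists_sum` confines all dimensions to a single compact set of configurations.
The maximum found there is positive because some realization exists. -/
theorem isGreatest_maxMargin [Fintype X] [Fintype Y] [Nonempty X] [Nonempty Y]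
    (f : X → Y → Bool) : IsGreatest (marginSet f) (maxMargin f) := by
  suffices h : ∃ γ, IsGreatest (marginSet f) γ by
    obtain ⟨γ, hγ⟩ := h
    rwa [maxMargin, hγ.csSup_eq]
  let E := EuclideanSpace ℝ (X ⊕ Y)
  let K : Set ((X → E) × (Y → E)) :=
    (Set.univ.pi fun _ => Metric.sphere 0 1) ×ˢ (Set.univ.pi fun _ => Metric.sphere 0 1)
  have hK : IsCompact K :=
    (isCompact_univ_pi fun _ => isCompact_sphere _ _).prod
      (isCompact_univ_pi fun _ => isCompact_sphere _ _)
  let F : (X → E) × (Y → E) → ℝ := fun p =>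
    Finset.univ.inf' Finset.univ_nonempty fun i : X × Y =>
      bitSign (f i.1 i.2) * inner ℝ (p.1 i.1) (p.2 i.2)
  have hF : Continuous F := by
    refine Continuous.finset_inf'_apply _ fun i _ => ?_
    exact continuous_const.mul
      (((continuous_apply i.1).comp continuous_fst).inner
        ((continuous_apply i.2).comp continuous_snd))
  have key : ∀ γ ∈ marginSet f, ∃ p ∈ K, γ ≤ F p := by
    rintro γ ⟨d, α, β, h⟩
    obtain ⟨α', β', h'⟩ := h.exists_sum
    obtain ⟨h1, h2, -, h4⟩ := isRealization_iff_bitSign.1 h'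
    exact ⟨(α', β'), ⟨fun x _ => by simpa using h1 x, fun y _ => by simpa using h2 y⟩,
      Finset.le_inf' _ _ fun i _ => h4 i.1 i.2⟩
  obtain ⟨γ₀, hγ₀⟩ := marginSet_nonempty f
  obtain ⟨p₀, hp₀, hle⟩ := key γ₀ hγ₀
  obtain ⟨p, hp, hmax⟩ := hK.exists_isMaxOn ⟨p₀, hp₀⟩ hF.continuousOn
  have hγ₀pos : 0 < γ₀ := by
    obtain ⟨d, α, β, h⟩ := hγ₀
    exact h.pos
  refine ⟨F p, IsRealization.mem_marginSet (α := p.1) (β := p.2)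
    (isRealization_iff_bitSign.2 ⟨fun x => ?_, fun y => ?_, ?_, fun x y => ?_⟩), fun γ hγ => ?_⟩
  · simpa using hp.1 x trivial
  · simpa using hp.2 y trivial
  · exact hγ₀pos.trans_le (hle.trans (hmax hp₀))
  · exact Finset.inf'_le (s := Finset.univ) (fun i : X × Y =>
      bitSign (f i.1 i.2) * inner ℝ (p.1 i.1) (p.2 i.2)) (Finset.mem_univ (x, y))
  · obtain ⟨p', hp', hle'⟩ := key γ hγ
    exact hle'.trans (hmax hp')

theorem maxMargin_pos [Fintype X] [Fintype Y] [Nonempty X] [Nonempty Y] (f : X → Y → Bool) :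
    0 < maxMargin f := by
  obtain ⟨d, α, β, h⟩ := (isGreatest_maxMargin f).1
  exact h.pos

end Realization

/-! ### Tensor powers, an extra coordinate, and margins from thresholds. -/

section Vectors

variable {X Y ι : Type*} [Fintype ι]

/-- The `m`-th tensor power of a vector. -/
def tensorPower (m : ℕ) (a : EuclideanSpace ℝ ι) : EuclideanSpace ℝ (Fin m → ι) :=
  WithLp.toLp 2 fun j => ∏ i, a (j i)

theorem inner_tensorPower (m : ℕ) (a b : EuclideanSpace ℝ ι) :
    inner ℝ (tensorPower m a) (tensorPower m b) = inner ℝ a b ^ m := by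
  simp only [PiLp.inner_apply, tensorPower, Fintype.sum_pow]
  refine Finset.sum_congr rfl fun j _ => ?_
  simp [Finset.prod_mul_distrib]

theorem norm_tensorPower (m : ℕ) {a : EuclideanSpace ℝ ι} (ha : ‖a‖ = 1) :
    ‖tensorPower m a‖ = 1 := by
  rw [norm_eq_sqrt_real_inner, inner_tensorPower, real_inner_self_eq_norm_sq, ha]
  simp

/-- The vector `(s, a)`. -/
def consCoord (s : ℝ) (a : EuclideanSpace ℝ ι) : EuclideanSpace ℝ (Option ι) :=
  WithLp.toLp 2 fun o => o.elim s a

theorem inner_consCoord (s t : ℝ) (a b : EuclideanSpace ℝ ι) :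
    inner ℝ (consCoord s a) (consCoord t b) = s * t + inner ℝ a b := by
  simp [PiLp.inner_apply, consCoord, Fintype.sum_option, mul_comm]

theorem norm_consCoord (s : ℝ) (a : EuclideanSpace ℝ ι) :
    ‖consCoord s a‖ = √(s ^ 2 + ‖a‖ ^ 2) := by
  rw [norm_eq_sqrt_real_inner, inner_consCoord, real_inner_self_eq_norm_sq, sq s]

/-- Unit vectors whose inner products lie below `t - ε` or above `t + ε` according to `f` turn
into a realization. -/
theorem half_mem_marginSet {f : X → Y → Bool} {v : X → EuclideanSpace ℝ ι}
    {w : Y → EuclideanSpace ℝ ι} {t ε : ℝ} (hv : ∀ x, ‖v x‖ = 1) (hw : ∀ y, ‖w y‖ = 1)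
    (ht₀ : 0 ≤ t) (ht₁ : t ≤ 1) (hε : 0 < ε)
    (h₀ : ∀ x y, f x y = false → inner ℝ (v x) (w y) ≤ t - ε)
    (h₁ : ∀ x y, f x y = true → t + ε ≤ inner ℝ (v x) (w y)) : ε / 2 ∈ marginSet f := by
  -- An extra coordinate `√t` on both sides, with `w` negated, moves the threshold from `t` to `0`.
  -- Normalizing divides inner products by `t + 1 ≤ 2`, whence the loss of a factor `2`.
  set k : ℝ := (√(t + 1))⁻¹ with hk
  have hs : 0 < √(t + 1) := Real.sqrt_pos.2 (by linarith)
  have hkk : k * k = (t + 1)⁻¹ := by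
    rw [hk, ← mul_inv, Real.mul_self_sqrt (by linarith)]
  have hnorm : ∀ a : EuclideanSpace ℝ ι, ‖a‖ = 1 → ‖k • consCoord (√t) a‖ = 1 := fun a ha => by
    rw [norm_smul, norm_consCoord, ha, Real.sq_sqrt ht₀, one_pow, hk, norm_inv, Real.norm_eq_abs,
      abs_of_pos hs, inv_mul_cancel₀ hs.ne']
  have hinner : ∀ x y, inner ℝ (k • consCoord (√t) (v x)) (k • consCoord (√t) (-w y)) =
      (t + 1)⁻¹ * (t - inner ℝ (v x) (w y)) := fun x y => by
    rw [real_inner_smul_left, real_inner_smul_right, inner_consCoord, inner_neg_right,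
      Real.mul_self_sqrt ht₀, ← mul_assoc, hkk, sub_eq_add_neg]
  have hle : ε / 2 ≤ (t + 1)⁻¹ * ε := by
    rw [inv_mul_eq_div]
    exact div_le_div_of_nonneg_left hε.le (by linarith) (by linarith)
  have hpos : 0 ≤ (t + 1)⁻¹ := inv_nonneg.2 (by linarith)
  refine IsRealization.mem_marginSet (α := fun x => k • consCoord (√t) (v x))
    (β := fun y => k • consCoord (√t) (-w y))
    ⟨fun x => hnorm _ (hv x), fun y => hnorm _ (by rw [norm_neg, hw]), by linarith,
      fun x y hf => ?_, fun x y hf => ?_⟩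
  · rw [hinner]
    exact hle.trans (mul_le_mul_of_nonneg_left (by linarith [h₀ x y hf]) hpos)
  · rw [hinner]
    have := mul_le_mul_of_nonneg_left (show t - inner ℝ (v x) (w y) ≤ -ε by
      linarith [h₁ x y hf]) hpos
    linarith

end Vectors

/-! ### Distinguishing product distributions: a `χ²` bound. -/

section ChiSquared

variable {Ω : Type*} [Fintype Ω]

/-- A test on `r` independent samples separates two distributions only if their `χ²`-divergence
is large. -/
theorem sq_sum_prod_sub_prod_mul_le {p q : Ω → ℝ} (hq : ∀ z, 0 < q z) (hp1 : ∑ z, p z = 1)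
    (hq1 : ∑ z, q z = 1) (r : ℕ) {T : (Fin r → Ω) → ℝ} (hT : ∀ z, T z ∈ Set.Icc (0 : ℝ) 1) :
    (∑ z, (∏ i, p (z i)) * T z - ∑ z, (∏ i, q (z i)) * T z) ^ 2 ≤
      ((∑ z, p z ^ 2 / q z) ^ r - 1) / 4 := by
  set P : (Fin r → Ω) → ℝ := fun z => ∏ i, p (z i) with hP
  set Q : (Fin r → Ω) → ℝ := fun z => ∏ i, q (z i) with hQ
  have hQpos : ∀ z, 0 < Q z := fun z => Finset.prod_pos fun i _ => hq _
  have hP1 : ∑ z, P z = 1 := by rw [hP, ← Fintype.sum_pow, hp1, one_pow]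
  have hQ1 : ∑ z, Q z = 1 := by rw [hQ, ← Fintype.sum_pow, hq1, one_pow]
  have hPQ : ∑ z, P z ^ 2 / Q z = (∑ z, p z ^ 2 / q z) ^ r := by
    rw [Fintype.sum_pow]
    refine Finset.sum_congr rfl fun z _ => ?_
    rw [Finset.prod_div_distrib, Finset.prod_pow]
  -- Both distributions have mass `1`, so `T` may be centred at `1/2`; after Cauchy–Schwarz this
  -- yields the factor `1/4`.
  have h1 : ∑ z, P z * T z - ∑ z, Q z * T z =
      ∑ z, ((P z - Q z) / √(Q z)) * (√(Q z) * (T z - 1 / 2)) := by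
    have : ∀ z, ((P z - Q z) / √(Q z)) * (√(Q z) * (T z - 1 / 2)) =
        P z * T z - Q z * T z - (P z - Q z) / 2 := fun z => by
      have := (Real.sqrt_pos.2 (hQpos z)).ne'
      field_simp
    simp only [this, Finset.sum_sub_distrib, ← Finset.sum_div, hP1, hQ1]
    ring
  have h2 : ∑ z, ((P z - Q z) / √(Q z)) ^ 2 = (∑ z, p z ^ 2 / q z) ^ r - 1 := by
    have : ∀ z, ((P z - Q z) / √(Q z)) ^ 2 = P z ^ 2 / Q z - 2 * P z + Q z := fun z => by
      have := (hQpos z).ne'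
      rw [div_pow, Real.sq_sqrt (hQpos z).le]
      field_simp
      ring
    simp only [this, Finset.sum_sub_distrib, Finset.sum_add_distrib, ← Finset.mul_sum, hP1, hQ1,
      hPQ]
    ring
  have h3 : ∑ z, (√(Q z) * (T z - 1 / 2)) ^ 2 ≤ 1 / 4 := by
    calc ∑ z, (√(Q z) * (T z - 1 / 2)) ^ 2 ≤ ∑ z, Q z * (1 / 4) := by
          refine Finset.sum_le_sum fun z _ => ?_
          rw [mul_pow, Real.sq_sqrt (hQpos z).le]
          refine mul_le_mul_of_nonneg_left ?_ (hQpos z).le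
          nlinarith [(hT z).1, (hT z).2]
      _ = 1 / 4 := by rw [← Finset.sum_mul, hQ1, one_mul]
  rw [h1]
  refine (Finset.sum_mul_sq_le_sq_mul_sq _ _ _).trans ?_
  rw [h2, div_eq_mul_one_div (_ - 1 : ℝ) 4]
  refine mul_le_mul_of_nonneg_left h3 ?_
  rw [← h2]
  exact Finset.sum_nonneg fun z _ => sq_nonneg _

end ChiSquared

/-! ### Lower bound on the number of copies. -/

section LowerBound

/-- A power that spreads `1 - u₀` and `1 - u₁` apart. -/
theorem exists_pow_sub_pow_ge {u₀ u₁ : ℝ} (h₀ : 0 ≤ u₀) (h : u₀ < u₁) (h₁ : u₁ ≤ 1) :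
    ∃ m : ℕ, (u₁ - u₀) / (4 * u₁) ≤ (1 - u₀) ^ m - (1 - u₁) ^ m := by
  have hu : 0 < u₁ := h₀.trans_lt h
  -- The exponent `k + 1` is about `1/(2u₁)`: large enough to multiply the gap by that order, while
  -- `k u₁ < 1/2` keeps `(1 - u₁)^k ≥ 1/2` by Bernoulli.
  obtain ⟨k, hk⟩ : ∃ k, ⌈1 / (2 * u₁)⌉₊ = k + 1 :=
    Nat.exists_eq_succ_of_ne_zero (Nat.ceil_pos.2 (by positivity)).ne'
  refine ⟨k + 1, ?_⟩
  have hle : 1 / (2 * u₁) ≤ (k : ℝ) + 1 := by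
    have := Nat.le_ceil (1 / (2 * u₁))
    rw [hk] at this
    exact_mod_cast this
  have hlt : (k : ℝ) < 1 / (2 * u₁) := by
    have := Nat.ceil_lt_add_one (show 0 ≤ 1 / (2 * u₁) by positivity)
    rw [hk] at this
    push_cast at this
    linarith
  rw [lt_div_iff₀ (by positivity)] at hlt
  rw [div_le_iff₀ (by positivity)] at hle
  have hB : 1 / 2 ≤ (1 - u₁) ^ k := by
    have := one_add_mul_le_pow (show (-2 : ℝ) ≤ -u₁ by linarith) k
    rw [← sub_eq_add_neg] at this
    linarith
  have hgeom : (k + 1 : ℝ) * (1 - u₁) ^ k * (u₁ - u₀) ≤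
      (1 - u₀) ^ (k + 1) - (1 - u₁) ^ (k + 1) := by
    rw [← (Commute.all (1 - u₀) (1 - u₁)).geom_sum₂_mul, show 1 - u₀ - (1 - u₁) = u₁ - u₀ by ring]
    refine mul_le_mul_of_nonneg_right ?_ (by linarith)
    have : ∑ i ∈ Finset.range (k + 1), (1 - u₁) ^ k = (k + 1 : ℝ) * (1 - u₁) ^ k := by simp
    rw [← this]
    refine Finset.sum_le_sum fun i hi => ?_
    have hi' : i + (k + 1 - 1 - i) = k := by
      have := Finset.mem_range.1 hi
      omega
    calc (1 - u₁) ^ k = (1 - u₁) ^ i * (1 - u₁) ^ (k + 1 - 1 - i) := by rw [← pow_add, hi']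
      _ ≤ _ := by
        refine mul_le_mul_of_nonneg_right (pow_le_pow_left₀ (by linarith) (by linarith) _)
          (pow_nonneg (by linarith) _)
  refine le_trans ?_ hgeom
  rw [div_le_iff₀ (by positivity)]
  have h2 : 1 ≤ 4 * u₁ * ((k + 1 : ℝ) * (1 - u₁) ^ k) := by
    have := mul_le_mul_of_nonneg_left hB (show 0 ≤ 4 * u₁ * (k + 1 : ℝ) by positivity)
    linarith
  nlinarith [mul_le_mul_of_nonneg_left h2 (show 0 ≤ u₁ - u₀ by linarith)]

variable {X Y ι : Type*} [Fintype ι] {f : X → Y → Bool}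

/-- Margins from threshold embeddings. -/
theorem IsThresholdEmbedding.exists_mem_marginSet {α : X → EuclideanSpace ℝ ι}
    {β : Y → EuclideanSpace ℝ ι} {δ₀ δ₁ : ℝ} (h : IsThresholdEmbedding f α β δ₀ δ₁)
    (h₀ : 0 ≤ δ₀) (hlt : δ₀ < δ₁) (h₁ : δ₁ ≤ 1) :
    ∃ γ ∈ marginSet f, (δ₁ - δ₀) / (16 * (1 - δ₀)) ≤ γ := by
  -- The tensor power used is `2 * m`, since the thresholds bound squares of inner products.
  obtain ⟨m, hm⟩ := exists_pow_sub_pow_ge (u₀ := 1 - δ₁) (u₁ := 1 - δ₀) (by linarith) (by linarith)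
    (by linarith)
  have hpos : 0 < (δ₁ - δ₀) / (4 * (1 - δ₀)) := div_pos (by linarith) (by linarith)
  simp only [sub_sub_cancel, sub_sub_sub_cancel_left] at hm
  have hinner : ∀ x y, inner ℝ (tensorPower (2 * m) (α x)) (tensorPower (2 * m) (β y)) =
      (|inner ℝ (α x) (β y)| ^ 2) ^ m := fun x y => by
    rw [inner_tensorPower, pow_mul, sq_abs]
  have hd0 : 0 ≤ δ₀ ^ m := pow_nonneg h₀ _
  have hd1 : δ₁ ^ m ≤ 1 := pow_le_one₀ (by linarith) h₁
  refine ⟨_, half_mem_marginSet (f := f) (v := fun x => tensorPower (2 * m) (α x))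
    (w := fun y => tensorPower (2 * m) (β y)) (t := (δ₁ ^ m + δ₀ ^ m) / 2)
    (ε := (δ₁ ^ m - δ₀ ^ m) / 2) (fun x => norm_tensorPower _ (h.norm_left x))
    (fun y => norm_tensorPower _ (h.norm_right y)) (by linarith) (by linarith) (by linarith)
    (fun x y hf => ?_) (fun x y hf => ?_), ?_⟩
  · rw [hinner]
    linarith [pow_le_pow_left₀ (sq_nonneg _) (h.inner_sq_le x y hf) m]
  · rw [hinner]
    linarith [pow_le_pow_left₀ (by linarith) (h.le_inner_sq x y hf) m]
  · have : (δ₁ - δ₀) / (16 * (1 - δ₀)) = (δ₁ - δ₀) / (4 * (1 - δ₀)) / 4 := by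
      rw [div_div]; congr 1; ring
    linarith

theorem one_mem_marginSet_of_const {b : Bool} (h : ∀ x y, f x y = b) : 1 ∈ marginSet f := by
  refine IsRealization.mem_marginSet (ι := Unit) (α := fun _ => EuclideanSpace.single () 1)
    (β := fun _ => EuclideanSpace.single () (bitSign b)) (isRealization_iff_bitSign.2
      ⟨fun x => by simp, fun y => ?_, one_pos, fun x y => ?_⟩)
  · simp [abs_bitSign]
  · rw [EuclideanSpace.inner_single_left, h]
    simp [bitSign_mul_self]

theorem abs_inner_sq_le_one {a b : EuclideanSpace ℝ ι} (ha : ‖a‖ = 1) (hb : ‖b‖ = 1) :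
    |inner ℝ a b| ^ 2 ≤ 1 := by
  have := abs_real_inner_le_norm a b
  rw [ha, hb, one_mul] at this
  exact pow_le_one₀ (abs_nonneg _) this

theorem sum_swapTestProb {q : ℕ} (a b : QubitVector q) : ∑ z, swapTestProb a b z = 1 := by
  simp only [swapTestProb, Fintype.sum_bool, Bool.true_eq_false, if_false, if_true]
  ring

/-- Two inputs of different value force the number of copies up. -/
theorem quarter_le_copies_mul {q r : ℕ} {P : SwapTestProtocol X Y q r}
    (hP : P.IsRepeatedFingerprintingFor f) {x₀ x₁ : X} {y₀ y₁ : Y} (h₀ : f x₀ y₀ = false)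
    (h₁ : f x₁ y₁ = true) {δ₀ δ₁ : ℝ} (hδ₀ : |inner ℝ (P.alice x₀) (P.bob y₀)| ^ 2 = δ₀)
    (hδ₁ : |inner ℝ (P.alice x₁) (P.bob y₁)| ^ 2 = δ₁) (hlt : δ₀ < 1) :
    1 / 4 ≤ (r : ℝ) * ((δ₁ - δ₀) ^ 2 / (1 - δ₀)) := by
  have hδ₀0 : 0 ≤ δ₀ := hδ₀ ▸ sq_nonneg _
  -- The 0-input supplies the reference distribution: `δ₀ < 1` makes both of its outcomes possible,
  -- whereas `δ₁ = 1` is allowed.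
  have key := sq_sum_prod_sub_prod_mul_le (p := swapTestProb (P.alice x₁) (P.bob y₁))
    (q := swapTestProb (P.alice x₀) (P.bob y₀)) (by
      intro z
      unfold swapTestProb
      rw [hδ₀]
      split_ifs <;> linarith) (sum_swapTestProb _ _) (sum_swapTestProb _ _) r P.referee_mem
  have hdiff : 1 / 3 ≤ P.outputOneProb x₁ y₁ - P.outputOneProb x₀ y₀ := by
    linarith [hP.correct_one x₁ y₁ h₁, hP.correct_zero x₀ y₀ h₀]
  have hchi : ∑ z, swapTestProb (P.alice x₁) (P.bob y₁) z ^ 2 /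
      swapTestProb (P.alice x₀) (P.bob y₀) z ≤ 1 + (δ₁ - δ₀) ^ 2 / (1 - δ₀) := by
    simp only [swapTestProb, hδ₀, hδ₁, Fintype.sum_bool]
    simp only [Bool.true_eq_false, if_false, if_true]
    have e : (1 / 2 - δ₁ / 2) ^ 2 / (1 / 2 - δ₀ / 2) + (1 / 2 + δ₁ / 2) ^ 2 / (1 / 2 + δ₀ / 2) =
        1 + (δ₁ - δ₀) ^ 2 / ((1 - δ₀) * (1 + δ₀)) := by
      have a1 : 1 - δ₀ ≠ 0 := by linarith
      have a2 : 1 + δ₀ ≠ 0 := by linarith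
      have a3 : 1 / 2 - δ₀ / 2 ≠ 0 := by intro h; apply a1; linarith
      have a4 : 1 / 2 + δ₀ / 2 ≠ 0 := by intro h; apply a2; linarith
      field_simp
      ring
    rw [e]
    have := div_le_div_of_nonneg_left (sq_nonneg (δ₁ - δ₀)) (show 0 < 1 - δ₀ by linarith)
      (show 1 - δ₀ ≤ (1 - δ₀) * (1 + δ₀) by nlinarith)
    linarith
  set c := (δ₁ - δ₀) ^ 2 / (1 - δ₀) with hc
  have hc0 : 0 ≤ c := div_nonneg (sq_nonneg _) (by linarith)
  have hpow : (∑ z, swapTestProb (P.alice x₁) (P.bob y₁) z ^ 2 /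
      swapTestProb (P.alice x₀) (P.bob y₀) z) ^ r ≤ Real.exp (r * c) := by
    rw [Real.exp_nat_mul]
    refine pow_le_pow_left₀ (Finset.sum_nonneg fun z _ => div_nonneg (sq_nonneg _) ?_)
      (hchi.trans (by linarith [Real.add_one_le_exp c])) r
    unfold swapTestProb
    rw [hδ₀]
    split_ifs <;> linarith
  have h4 : (1 / 3 : ℝ) ^ 2 ≤ (Real.exp (r * c) - 1) / 4 :=
    (pow_le_pow_left₀ (by norm_num) hdiff 2).trans (key.trans (by linarith))
  -- `h4` forces `exp (r * c) ≥ 13/9`, while `r * c < 1/4` would give at most `4/3`.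
  by_contra! hlt'
  have h5 : Real.exp (r * c) ≤ Real.exp (1 / 4) := Real.exp_le_exp.2 hlt'.le
  have h6 : Real.exp (1 / 4) ≤ 4 / 3 := by
    have := Real.add_one_le_exp (-(1 / 4 : ℝ))
    rw [Real.exp_neg] at this
    have h7 := inv_anti₀ (by norm_num) this
    rw [inv_inv] at h7
    norm_num at h7 ⊢
    exact h7
  norm_num at h4
  linarith

theorem le_copies_of_isRepeatedFingerprintingFor [Fintype X] [Fintype Y] [Nonempty X] [Nonempty Y]
    {q r : ℕ} {P : SwapTestProtocol X Y q r} (hP : P.IsRepeatedFingerprintingFor f) :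
    1 / 1024 / maxMargin f ^ 2 ≤ (r : ℝ) := by
  have hγ := maxMargin_pos f
  have hr : (1 : ℝ) ≤ r := by exact_mod_cast P.one_le_copies
  rw [div_le_iff₀ (by positivity)]
  -- For constant `f` there is nothing to distinguish; the margin is then at least `1`, and `r ≥ 1`
  -- suffices.
  by_cases hconst : ∃ b, ∀ x y, f x y = b
  · obtain ⟨b, hb⟩ := hconst
    have h1 : 1 ≤ maxMargin f := (isGreatest_maxMargin f).2 (one_mem_marginSet_of_const hb)
    nlinarith
  push Not at hconst
  obtain ⟨xf, yf, hf⟩ := hconst true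
  obtain ⟨xt, yt, ht⟩ := hconst false
  -- The given thresholds are replaced by the attained extremes, so that the same `δ₀`, `δ₁` enter
  -- both the margin and the `χ²` estimate.
  let g : X × Y → ℝ := fun z => |inner ℝ (P.alice z.1) (P.bob z.2)| ^ 2
  obtain ⟨⟨x₀, y₀⟩, hz₀, hmax⟩ := Finset.exists_max_image
    (Finset.univ.filter fun z : X × Y => f z.1 z.2 = false) g ⟨(xf, yf), by simpa using hf⟩
  obtain ⟨⟨x₁, y₁⟩, hz₁, hmin⟩ := Finset.exists_min_image
    (Finset.univ.filter fun z : X × Y => f z.1 z.2 = true) g ⟨(xt, yt), by simpa using ht⟩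
  simp only [Finset.mem_filter, Finset.mem_univ, true_and] at hz₀ hz₁ hmax hmin
  obtain ⟨d₀, d₁, hd, hemb⟩ := hP.threshold
  have hlt : g (x₀, y₀) < g (x₁, y₁) :=
    (hemb.inner_sq_le _ _ hz₀).trans_lt (hd.trans_le (hemb.le_inner_sq _ _ hz₁))
  have hle1 : g (x₁, y₁) ≤ 1 := abs_inner_sq_le_one (P.norm_alice _) (P.norm_bob _)
  have hemb' : IsThresholdEmbedding f P.alice P.bob (g (x₀, y₀)) (g (x₁, y₁)) :=
    ⟨P.norm_alice, P.norm_bob, fun x y h => hmax (x, y) h, fun x y h => hmin (x, y) h⟩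
  have h0 : 0 ≤ g (x₀, y₀) := sq_nonneg _
  obtain ⟨γ, hγmem, hγle⟩ := hemb'.exists_mem_marginSet h0 hlt hle1
  have hcop := quarter_le_copies_mul hP hz₀ hz₁ (δ₀ := g (x₀, y₀)) (δ₁ := g (x₁, y₁)) rfl rfl
    (by linarith)
  set δ₀ := g (x₀, y₀)
  set δ₁ := g (x₁, y₁)
  have hu : 0 < 1 - δ₀ := by linarith
  -- The margin bound even gives an additional factor `1 - δ₀ ≤ 1` on the right.
  have h2 : (δ₁ - δ₀) ^ 2 / (1 - δ₀) ≤ 256 * maxMargin f ^ 2 := by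
    have h3 : ((δ₁ - δ₀) / (16 * (1 - δ₀))) ^ 2 ≤ maxMargin f ^ 2 :=
      pow_le_pow_left₀ (div_nonneg (by linarith) (by linarith))
        (hγle.trans ((isGreatest_maxMargin f).2 hγmem)) 2
    rw [div_pow, div_le_iff₀ (by positivity)] at h3
    rw [div_le_iff₀ hu]
    nlinarith [mul_nonneg (mul_nonneg (sq_nonneg (maxMargin f)) hu.le) h0]
  nlinarith [mul_le_mul_of_nonneg_left h2 (show (0 : ℝ) ≤ r by linarith)]

end LowerBound

/-! ### Exponential tail bound for independent samples. -/

section Chernoff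

variable {Ω : Type*} [Fintype Ω]

/-- The Chernoff bound for `k` independent samples. -/
theorem sum_filter_prod_le_exp {p W : Ω → ℝ} (hp : ∀ z, 0 ≤ p z) {l A : ℝ} (hl : 0 ≤ l)
    (h : ∑ z, p z * Real.exp (l * W z) ≤ Real.exp A) (k : ℕ) (T : ℝ) :
    ∑ ω : Fin k → Ω with T ≤ ∑ i, W (ω i), ∏ i, p (ω i) ≤ Real.exp (k * A - l * T) := by
  have h1 : ∑ ω : Fin k → Ω with T ≤ ∑ i, W (ω i), ∏ i, p (ω i) ≤
      ∑ ω : Fin k → Ω, (∏ i, p (ω i)) * Real.exp (l * (∑ i, W (ω i) - T)) := by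
    rw [Finset.sum_filter]
    refine Finset.sum_le_sum fun ω _ => ?_
    have h0 : 0 ≤ ∏ i, p (ω i) := Finset.prod_nonneg fun i _ => hp _
    split_ifs with hT
    · exact le_mul_of_one_le_right h0 (Real.one_le_exp (mul_nonneg hl (by linarith)))
    · positivity
  refine h1.trans ?_
  have h2 : ∀ ω : Fin k → Ω, (∏ i, p (ω i)) * Real.exp (l * (∑ i, W (ω i) - T)) =
      (∏ i, p (ω i) * Real.exp (l * W (ω i))) * Real.exp (-(l * T)) := fun ω => by
    rw [Finset.prod_mul_distrib, ← Real.exp_sum, mul_assoc, ← Real.exp_add, ← Finset.mul_sum]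
    congr 2
    ring
  simp only [h2]
  rw [← Finset.sum_mul, ← Fintype.sum_pow (fun z => p z * Real.exp (l * W z)), sub_eq_add_neg,
    Real.exp_add, Real.exp_nat_mul]
  refine mul_le_mul_of_nonneg_right (pow_le_pow_left₀ ?_ h k) (Real.exp_pos _).le
  exact Finset.sum_nonneg fun z _ => mul_nonneg (hp z) (Real.exp_pos _).le

end Chernoff

/-! ### Random signs: moment bounds and approximate preservation of inner products. -/

section Rademacher

/-- The signed sum `∑ ± aᵢ`. -/
def signedSum {N : ℕ} (a : Fin N → ℝ) (ω : Fin N → Bool) : ℝ := ∑ i, bitSign (ω i) * a i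

theorem signedSum_cons {N : ℕ} (a : Fin (N + 1) → ℝ) (b : Bool) (ω : Fin N → Bool) :
    signedSum a (Fin.cons b ω : Fin (N + 1) → Bool) =
      bitSign b * a 0 + signedSum (fun i => a i.succ) ω := by
  simp [signedSum, Fin.sum_univ_succ]

theorem sum_bool_tuple_succ {N : ℕ} (F : (Fin (N + 1) → Bool) → ℝ) :
    ∑ ω, F ω = ∑ ω : Fin N → Bool, F (Fin.cons true ω : Fin (N + 1) → Bool) +
      ∑ ω : Fin N → Bool, F (Fin.cons false ω : Fin (N + 1) → Bool) := by
  rw [← (Fin.consEquiv fun _ : Fin (N + 1) => Bool).sum_comp, Fintype.sum_prod_type,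
    Fintype.sum_bool]
  rfl

theorem sum_signedSum_mul {N : ℕ} (a b : Fin N → ℝ) (u v : ℝ) :
    ∑ ω, (u + signedSum a ω) * (v + signedSum b ω) = 2 ^ N * (u * v + ∑ i, a i * b i) := by
  induction N generalizing u v with
  | zero => simp [signedSum]
  | succ N ih =>
    rw [sum_bool_tuple_succ]
    simp only [signedSum_cons, ← add_assoc, ih, Fin.sum_univ_succ]
    simp only [bitSign, if_true, Bool.false_eq_true, if_false]
    ring

/-- Averaging over one sign with `cosh y ≤ exp (y²/2)` moves `a 0 ^ 2` from the sum into `D`,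
leaving `D + ∑ i, a i ^ 2` fixed. The offset `u` and the free `D` make the induction close. -/
theorem sum_exp_sq_signedSum_le {N : ℕ} (a : Fin N → ℝ) {D : ℝ} (hD : 0 < D) (u : ℝ) :
    ∑ ω, Real.exp ((u + signedSum a ω) ^ 2 / (2 * (D + ∑ i, a i ^ 2))) ≤
      2 ^ N * Real.exp ((∑ i, a i ^ 2 + u ^ 2) / (2 * D)) := by
  induction N generalizing u D with
  | zero => simp [signedSum]
  | succ N ih =>
    set x := a 0 with hx
    set S := ∑ i : Fin N, a i.succ ^ 2 with hS
    have hS0 : 0 ≤ S := Finset.sum_nonneg fun i _ => sq_nonneg _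
    have hD' : 0 < D + x ^ 2 := by positivity
    rw [sum_bool_tuple_succ]
    simp only [signedSum_cons, Fin.sum_univ_succ, ← add_assoc]
    rw [← hx, ← hS]
    refine (add_le_add (ih (fun i => a i.succ) hD' _) (ih (fun i => a i.succ) hD' _)).trans ?_
    simp only [bitSign, if_true, Bool.false_eq_true, if_false]
    rw [← hS]
    have e1 : (S + (u + -1 * x) ^ 2) / (2 * (D + x ^ 2)) =
        (S + u ^ 2 + x ^ 2) / (2 * (D + x ^ 2)) + -(u * x / (D + x ^ 2)) := by
      field_simp; ring
    have e2 : (S + (u + 1 * x) ^ 2) / (2 * (D + x ^ 2)) =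
        (S + u ^ 2 + x ^ 2) / (2 * (D + x ^ 2)) + u * x / (D + x ^ 2) := by
      field_simp; ring
    rw [e1, e2, Real.exp_add, Real.exp_add]
    have hcosh := Real.cosh_le_exp_half_sq (u * x / (D + x ^ 2))
    rw [Real.cosh_eq] at hcosh
    have hfin : Real.exp ((S + u ^ 2 + x ^ 2) / (2 * (D + x ^ 2))) *
        Real.exp ((u * x / (D + x ^ 2)) ^ 2 / 2) ≤ Real.exp ((x ^ 2 + S + u ^ 2) / (2 * D)) := by
      rw [← Real.exp_add, Real.exp_le_exp]
      have h1 : (S + x ^ 2) / (2 * (D + x ^ 2)) ≤ (S + x ^ 2) / (2 * D) :=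
        div_le_div_of_nonneg_left (by positivity) (by positivity) (by nlinarith [sq_nonneg x])
      have h2 : u ^ 2 / (2 * (D + x ^ 2)) + (u * x / (D + x ^ 2)) ^ 2 / 2 ≤ u ^ 2 / (2 * D) := by
        have e : u ^ 2 / (2 * (D + x ^ 2)) + (u * x / (D + x ^ 2)) ^ 2 / 2 =
            u ^ 2 * (D + 2 * x ^ 2) / (2 * (D + x ^ 2) ^ 2) := by
          field_simp; ring
        rw [e, div_le_div_iff₀ (by positivity) (by positivity)]
        nlinarith [mul_nonneg (sq_nonneg u) (sq_nonneg (x ^ 2))]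
      have e3 : (S + u ^ 2 + x ^ 2) / (2 * (D + x ^ 2)) =
          (S + x ^ 2) / (2 * (D + x ^ 2)) + u ^ 2 / (2 * (D + x ^ 2)) := by ring
      have e4 : (x ^ 2 + S + u ^ 2) / (2 * D) = (S + x ^ 2) / (2 * D) + u ^ 2 / (2 * D) := by ring
      rw [e3, e4]
      linarith
    have h3 := mul_le_mul_of_nonneg_left hcosh
      (Real.exp_pos ((S + u ^ 2 + x ^ 2) / (2 * (D + x ^ 2)))).le
    have h4 := mul_le_mul_of_nonneg_left (h3.trans hfin) (show (0 : ℝ) ≤ 2 * 2 ^ N by positivity)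
    rw [pow_succ (2 : ℝ) N]
    linarith

theorem sum_exp_sq_signedSum_div_four_le {N : ℕ} {a : Fin N → ℝ} (ha : ∑ i, a i ^ 2 = 1) :
    ∑ ω, Real.exp (signedSum a ω ^ 2 / 4) ≤ 2 ^ N * 2 := by
  have h := sum_exp_sq_signedSum_le a one_pos 0
  rw [ha] at h
  norm_num at h
  refine h.trans (mul_le_mul_of_nonneg_left ?_ (by positivity))
  have := Real.add_one_le_exp (-(1 / 2 : ℝ))
  rw [Real.exp_neg] at this
  have h7 := inv_anti₀ (by norm_num) this
  rw [inv_inv] at h7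
  norm_num at h7 ⊢
  exact h7

theorem exp_le_one_add_add_sq_mul_exp_abs (x : ℝ) :
    Real.exp x ≤ 1 + x + x ^ 2 * Real.exp |x| := by
  have h := Complex.norm_exp_sub_sum_le_norm_mul_exp (x : ℂ) 2
  simp only [Finset.sum_range_succ, Finset.sum_range_zero] at h
  have e : Complex.exp x - (0 + (x : ℂ) ^ 0 / (Nat.factorial 0 : ℕ) +
      (x : ℂ) ^ 1 / (Nat.factorial 1 : ℕ)) = ((Real.exp x - (1 + x) : ℝ) : ℂ) := by
    push_cast
    simp
  rw [e, Complex.norm_real, Complex.norm_real, Real.norm_eq_abs, Real.norm_eq_abs, sq_abs] at h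
  linarith [le_abs_self (Real.exp x - (1 + x))]

/-- Controls the second-order Taylor term of `exp (l s t)` by quantities whose means over random
signs are at most `2` (`sum_exp_sq_signedSum_div_four_le`). -/
theorem sq_mul_exp_le (s t l : ℝ) (hl : |l| ≤ 1 / 8) :
    (s * t) ^ 2 * Real.exp |l * (s * t)| ≤
      64 * (Real.exp (s ^ 2 / 4) + Real.exp (t ^ 2 / 4)) := by
  set w := (s ^ 2 + t ^ 2) / 2 with hw
  have hw0 : 0 ≤ w := by positivity
  have hst : |s * t| ≤ w := by
    rw [abs_le, hw]
    constructor <;> nlinarith [sq_nonneg (s + t), sq_nonneg (s - t)]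
  have h1 : (s * t) ^ 2 ≤ 128 * Real.exp (w / 8) := by
    have := Real.quadratic_le_exp_of_nonneg (show 0 ≤ w / 8 by positivity)
    have h2 : (s * t) ^ 2 ≤ w ^ 2 := by
      rw [← sq_abs]; exact pow_le_pow_left₀ (abs_nonneg _) hst 2
    nlinarith
  have h3 : Real.exp |l * (s * t)| ≤ Real.exp (w / 8) := by
    rw [Real.exp_le_exp, abs_mul]
    have := mul_le_mul hl hst (abs_nonneg _) (by norm_num)
    linarith
  have h4 : Real.exp (w / 8) * Real.exp (w / 8) = Real.exp (s ^ 2 / 8) * Real.exp (t ^ 2 / 8) := by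
    rw [← Real.exp_add, ← Real.exp_add, hw]
    congr 1
    ring
  have h5 : ∀ z : ℝ, Real.exp (z / 4) = Real.exp (z / 8) ^ 2 := fun z => by
    rw [← Real.exp_nat_mul]; congr 1; push_cast; ring
  calc (s * t) ^ 2 * Real.exp |l * (s * t)| ≤ 128 * Real.exp (w / 8) * Real.exp (w / 8) :=
        mul_le_mul h1 h3 (Real.exp_pos _).le (by positivity)
    _ = 128 * (Real.exp (s ^ 2 / 8) * Real.exp (t ^ 2 / 8)) := by rw [mul_assoc, h4]
    _ ≤ _ := by
      rw [h5, h5]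
      nlinarith [sq_nonneg (Real.exp (s ^ 2 / 8) - Real.exp (t ^ 2 / 8))]

/-- The moment generating function of a product of two signed sums. -/
theorem sum_exp_signedSum_mul_le {N : ℕ} {a b : Fin N → ℝ} (ha : ∑ i, a i ^ 2 = 1)
    (hb : ∑ i, b i ^ 2 = 1) {l : ℝ} (hl : |l| ≤ 1 / 8) :
    ∑ ω, ((2 : ℝ) ^ N)⁻¹ * Real.exp (l * (signedSum a ω * signedSum b ω)) ≤
      Real.exp (l * ∑ i, a i * b i + 256 * l ^ 2) := by
  rw [← Finset.mul_sum, inv_mul_le_iff₀ (by positivity)]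
  have h1 : ∀ ω, Real.exp (l * (signedSum a ω * signedSum b ω)) ≤
      -- The linear term has exact mean `l * ∑ i, a i * b i`; the remainder has mean at most `64 l²
      -- (2 + 2) = 256 l²`.
      1 + l * (signedSum a ω * signedSum b ω) + l ^ 2 * (64 *
        (Real.exp (signedSum a ω ^ 2 / 4) + Real.exp (signedSum b ω ^ 2 / 4))) := fun ω => by
    have h2 := exp_le_one_add_add_sq_mul_exp_abs (l * (signedSum a ω * signedSum b ω))
    have h3 := mul_le_mul_of_nonneg_left (sq_mul_exp_le (signedSum a ω) (signedSum b ω) l hl)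
      (sq_nonneg l)
    rw [mul_pow l] at h2
    linarith
  have hm : ∑ ω, signedSum a ω * signedSum b ω = 2 ^ N * ∑ i, a i * b i := by
    simpa using sum_signedSum_mul a b 0 0
  refine (Finset.sum_le_sum fun ω _ => h1 ω).trans ?_
  simp only [Finset.sum_add_distrib, ← Finset.mul_sum, hm]
  have h5 := sum_exp_sq_signedSum_div_four_le ha
  have h6 := sum_exp_sq_signedSum_div_four_le hb
  have h7 := mul_le_mul_of_nonneg_left (add_le_add h5 h6) (show 0 ≤ l ^ 2 * 64 by positivity)
  have h8 := mul_le_mul_of_nonneg_left (Real.add_one_le_exp (l * ∑ i, a i * b i + 256 * l ^ 2))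
    (show (0 : ℝ) ≤ 2 ^ N by positivity)
  have hc : ∑ ω : Fin N → Bool, (1 : ℝ) = 2 ^ N := by simp
  rw [hc]
  linarith

/-- A random sign matrix approximately preserves inner products. -/
theorem exists_signs_abs_sub_lt {I : Type*} [Fintype I] {N : ℕ} {v : I → Fin N → ℝ}
    (hv : ∀ i, ∑ j, v i j ^ 2 = 1) {η : ℝ} (hη₀ : 0 < η) (hη₁ : η ≤ 1) {k : ℕ}
    (hk : 2 * (Fintype.card I : ℝ) ^ 2 < Real.exp (k * (η ^ 2 / 1024))) :
    ∃ R : Fin k → Fin N → Bool, ∀ i j,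
      |∑ m, signedSum (v i) (R m) * signedSum (v j) (R m) - k * ∑ l, v i l * v j l| < k * η := by
  by_contra! hcon
  let μ : I → I → ℝ := fun i j => ∑ l, v i l * v j l
  let W : I × I × Bool → (Fin N → Bool) → ℝ := fun e ω =>
    bitSign e.2.2 * (signedSum (v e.1) ω * signedSum (v e.2.1) ω)
  let T : I × I × Bool → ℝ := fun e => k * (bitSign e.2.2 * μ e.1 e.2.1 + η)
  let p : (Fin N → Bool) → ℝ := fun _ => ((2 : ℝ) ^ N)⁻¹
  have hp : ∀ z, 0 ≤ p z := fun _ => by positivity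
  have hp1 : ∑ z, p z = 1 := by simp [p]
  have hbad : ∀ R : Fin k → Fin N → Bool, ∃ e, T e ≤ ∑ m, W e (R m) := by
    intro R
    obtain ⟨i, j, hij⟩ := hcon R
    rcases le_abs.1 hij with h | h
    · refine ⟨(i, j, false), ?_⟩
      simp only [T, W, bitSign, ← Finset.mul_sum, μ, Bool.false_eq_true, if_false]
      linarith
    · refine ⟨(i, j, true), ?_⟩
      simp only [T, W, bitSign, ← Finset.mul_sum, μ, if_true]
      linarith
  have hchern : ∀ e, ∑ R : Fin k → Fin N → Bool with T e ≤ ∑ m, W e (R m), ∏ m, p (R m) ≤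
      Real.exp (-(k * (η ^ 2 / 1024))) := by
    rintro ⟨i, j, b⟩
    -- The value `η / 512` minimizes `256 l² - l η`, with minimum `-η² / 1024`.
    have h := sum_exp_signedSum_mul_le (hv i) (hv j) (l := bitSign b * (η / 512)) (by
      rw [abs_mul, abs_bitSign, one_mul, abs_of_nonneg (by positivity)]; linarith)
    refine (sum_filter_prod_le_exp (W := W (i, j, b)) hp (l := η / 512) (by positivity)
      (A := bitSign b * (η / 512) * μ i j + 256 * (bitSign b * (η / 512)) ^ 2) ?_ k _).trans
      (le_of_eq ?_)
    · refine le_trans (le_of_eq (Finset.sum_congr rfl fun ω _ => ?_)) h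
      simp only [p, W]
      congr 2
      ring
    · congr 1
      simp only [T]
      rw [mul_pow, sq (bitSign b), bitSign_mul_self]
      ring
  -- Union bound: if every `R` is bad for some pair and some side of the deviation, the `2 |I|²` bad
  -- events have total probability at least `1`.
  have h1 : (1 : ℝ) ≤ ∑ e : I × I × Bool,
      ∑ R : Fin k → Fin N → Bool with T e ≤ ∑ m, W e (R m), ∏ m, p (R m) := by
    calc (1 : ℝ) = ∑ R : Fin k → Fin N → Bool, ∏ m, p (R m) := by
          rw [← Fintype.sum_pow, hp1, one_pow]
      _ ≤ ∑ R : Fin k → Fin N → Bool, ∑ e : I × I × Bool,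
          if T e ≤ ∑ m, W e (R m) then ∏ m, p (R m) else 0 := by
          refine Finset.sum_le_sum fun R _ => ?_
          have h0 : 0 ≤ ∏ m, p (R m) := Finset.prod_nonneg fun m _ => hp (R m)
          obtain ⟨e, he⟩ := hbad R
          refine le_trans (le_of_eq (if_pos he).symm) (Finset.single_le_sum
            (f := fun e => if T e ≤ ∑ m, W e (R m) then ∏ m, p (R m) else 0)
            (fun e _ => ?_) (Finset.mem_univ e))
          split_ifs
          · exact h0
          · exact le_rfl
      _ = _ := by
          rw [Finset.sum_comm]
          simp only [Finset.sum_filter]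
  have h2 := h1.trans (Finset.sum_le_sum fun e _ => hchern e)
  rw [Finset.sum_const, nsmul_eq_mul, Finset.card_univ, Real.exp_neg, ← div_eq_mul_inv,
    one_le_div (Real.exp_pos _)] at h2
  simp only [Fintype.card_prod, Fintype.card_bool] at h2
  push_cast at h2
  linarith

end Rademacher

/-! ### Dimension reduction for realizations. -/

section DimensionReduction

variable {X Y : Type*} [Fintype X] [Fintype Y] [Nonempty X] [Nonempty Y] {f : X → Y → Bool}

/-- The dimension of a realization can be reduced to `O(n / γ²)` at the cost of a constant factor
in the margin. -/
theorem IsRealization.exists_fin {d : ℕ} {α : X → EuclideanSpace ℝ (Fin d)}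
    {β : Y → EuclideanSpace ℝ (Fin d)} {γ : ℝ} (h : IsRealization f α β γ) {n k : ℕ}
    (hX : Fintype.card X ≤ 2 ^ n) (hY : Fintype.card Y ≤ 2 ^ n)
    (hk : 4096 * (2 * n + 4) ≤ k * γ ^ 2) :
    ∃ (α' : X → EuclideanSpace ℝ (Fin k)) (β' : Y → EuclideanSpace ℝ (Fin k)),
      IsRealization f α' β' (γ / 3) := by
  have hγ := h.pos
  have hγ1 := h.le_one
  have hk0 : (0 : ℝ) < k := by
    by_contra! hk0
    have : (k : ℝ) * γ ^ 2 ≤ 0 := mul_nonpos_of_nonpos_of_nonneg hk0 (sq_nonneg _)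
    have : (0 : ℝ) ≤ n := Nat.cast_nonneg n
    linarith
  let v : X ⊕ Y → EuclideanSpace ℝ (Fin d) := Sum.elim α β
  have hv : ∀ i, ‖v i‖ = 1 := by
    rintro (x | y)
    · exact h.norm_left x
    · exact h.norm_right y
  have hinner : ∀ i j, ∑ l, v i l * v j l = inner ℝ (v i) (v j) := fun i j => by
    simp [PiLp.inner_apply, mul_comm]
  -- With `η = γ / 2` the exponent is `k γ² / 4096`, and `2 (2^(n+1))² < 2^(2n+4) ≤ exp (2n+4)`.
  have hcard : 2 * (Fintype.card (X ⊕ Y) : ℝ) ^ 2 < Real.exp (k * ((γ / 2) ^ 2 / 1024)) := by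
    have h1 : (Fintype.card (X ⊕ Y) : ℝ) ≤ 2 ^ (n + 1) := by
      rw [Fintype.card_sum]
      have : Fintype.card X + Fintype.card Y ≤ 2 ^ (n + 1) := by rw [pow_succ]; omega
      exact_mod_cast this
    have h2 : (2 : ℝ) * (2 ^ (n + 1)) ^ 2 < 2 ^ (2 * n + 4) := by
      have : (2 : ℝ) ^ (2 * n + 4) = 2 * (2 * (2 ^ (n + 1)) ^ 2) := by ring
      rw [this]
      have : (0 : ℝ) < (2 ^ (n + 1)) ^ 2 := by positivity
      linarith
    have h3 : (2 : ℝ) ^ (2 * n + 4) ≤ Real.exp (2 * n + 4) := by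
      have h4 : (2 : ℝ) ≤ Real.exp 1 := by linarith [Real.add_one_le_exp (1 : ℝ)]
      have h5 := pow_le_pow_left₀ (by norm_num) h4 (2 * n + 4)
      rw [← Real.exp_nat_mul] at h5
      simpa using h5
    have h6 : (2 * n + 4 : ℝ) ≤ k * ((γ / 2) ^ 2 / 1024) := by
      have : (k : ℝ) * ((γ / 2) ^ 2 / 1024) = k * γ ^ 2 / 4096 := by ring
      rw [this, le_div_iff₀ (by norm_num)]
      linarith
    have h7 := pow_le_pow_left₀ (Nat.cast_nonneg (Fintype.card (X ⊕ Y))) h1 2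
    linarith [Real.exp_le_exp.2 h6]
  obtain ⟨R, hR⟩ := exists_signs_abs_sub_lt (v := fun i => v i) (fun i => by
    have := hinner i i
    rw [real_inner_self_eq_norm_sq, hv] at this
    simpa [sq] using this) (η := γ / 2) (by positivity) (by linarith) hcard
  let u : X ⊕ Y → EuclideanSpace ℝ (Fin k) := fun i =>
    WithLp.toLp 2 fun m => signedSum (v i) (R m)
  have hu : ∀ i j, |inner ℝ (u i) (u j) - k * inner ℝ (v i) (v j)| < k * (γ / 2) := fun i j => by
    have e : inner ℝ (u i) (u j) = ∑ m, signedSum (v i) (R m) * signedSum (v j) (R m) := by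
      simp [PiLp.inner_apply, u, mul_comm]
    rw [e, ← hinner]
    exact hR i j
  have hun : ∀ i, 0 < ‖u i‖ ∧ ‖u i‖ ^ 2 ≤ 3 / 2 * k := fun i => by
    have h1 := abs_lt.1 (hu i i)
    rw [real_inner_self_eq_norm_sq, real_inner_self_eq_norm_sq, hv] at h1
    have h2 : (k : ℝ) * (γ / 2) ≤ k * (1 / 2) := mul_le_mul_of_nonneg_left (by linarith) hk0.le
    refine ⟨(norm_nonneg _).lt_of_ne fun h0 => ?_, by linarith⟩
    rw [← h0] at h1
    linarith
  obtain ⟨-, -, -, hsgn⟩ := isRealization_iff_bitSign.1 h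
  have hnorm : ∀ i, ‖‖u i‖⁻¹ • u i‖ = 1 := fun i => by
    rw [norm_smul, norm_inv, norm_norm, inv_mul_cancel₀ (hun i).1.ne']
  refine ⟨fun x => ‖u (.inl x)‖⁻¹ • u (.inl x), fun y => ‖u (.inr y)‖⁻¹ • u (.inr y),
    isRealization_iff_bitSign.2 ⟨fun x => hnorm _, fun y => hnorm _, by positivity,
      fun x y => ?_⟩⟩
  obtain ⟨hx0, hx⟩ := hun (.inl x)
  obtain ⟨hy0, hy⟩ := hun (.inr y)
  have hxy : ‖u (.inl x)‖ * ‖u (.inr y)‖ ≤ 3 / 2 * k := by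
    nlinarith [sq_nonneg (‖u (.inl x)‖ - ‖u (.inr y)‖)]
  -- The error costs half of `k γ`; dividing by norms whose product is at most `3k/2` leaves `γ /
  -- 3`.
  have hge : k * (γ / 2) ≤ bitSign (f x y) * inner ℝ (u (.inl x)) (u (.inr y)) := by
    have h1 : |bitSign (f x y) * (inner ℝ (u (.inl x)) (u (.inr y)) -
        k * inner ℝ (α x) (β y))| < k * (γ / 2) := by
      rw [abs_mul, abs_bitSign, one_mul]
      exact hu (.inl x) (.inr y)
    have h2 := mul_le_mul_of_nonneg_left (hsgn x y) hk0.le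
    have h3 := (abs_lt.1 h1).1
    nlinarith
  have e : bitSign (f x y) * inner ℝ (‖u (.inl x)‖⁻¹ • u (.inl x)) (‖u (.inr y)‖⁻¹ • u (.inr y)) =
      bitSign (f x y) * inner ℝ (u (.inl x)) (u (.inr y)) / (‖u (.inl x)‖ * ‖u (.inr y)‖) := by
    rw [real_inner_smul_left, real_inner_smul_right]
    field_simp
  rw [e, le_div_iff₀ (mul_pos hx0 hy0)]
  have := mul_le_mul_of_nonneg_left hxy (show 0 ≤ γ / 3 by positivity)
  linarith

end DimensionReduction

/-! ### The protocol and its resources. -/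

section UpperBound

theorem nonempty_linearIsometry_of_card_le {ι κ : Type*} [Fintype ι] [Fintype κ]
    (h : Fintype.card ι ≤ Fintype.card κ) :
    Nonempty (EuclideanSpace ℝ ι →ₗᵢ[ℝ] EuclideanSpace ℝ κ) := by
  classical
  obtain ⟨e⟩ := Function.Embedding.nonempty_of_card_le h
  let b := EuclideanSpace.basisFun ι ℝ
  let c := EuclideanSpace.basisFun κ ℝ
  refine ⟨(b.toBasis.constr ℝ (c ∘ e)).isometryOfOrthonormal (v := b.toBasis)
    (by simp [b.orthonormal]) ?_⟩
  have : ⇑(b.toBasis.constr ℝ (c ∘ e)) ∘ b.toBasis = c ∘ e :=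
    funext fun i => b.toBasis.constr_basis ℝ _ i
  rw [this]
  exact c.orthonormal.comp _ e.injective

variable {X Y : Type*} {f : X → Y → Bool}

/-- The number of swap tests with outcome `0`. -/
def zeroCount {r : ℕ} (z : Fin r → Bool) : ℝ := ∑ i, if z i = false then 1 else 0

/-- The moment generating function of the outcome of a swap test. -/
theorem sum_swapTestProb_mul_exp_le {q : ℕ} {a b : QubitVector q} (ha : ‖a‖ = 1) (hb : ‖b‖ = 1)
    {s l : ℝ} (hs : |s| = 1) (hl₀ : 0 ≤ l) (hl₁ : l ≤ 1) :
    ∑ z, swapTestProb a b z * Real.exp (l * (s * if z = false then 1 else 0)) ≤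
      Real.exp (l * s * (1 / 2 + |inner ℝ a b| ^ 2 / 2) + l ^ 2) := by
  have h1 := abs_inner_sq_le_one ha hb
  have h0 : 0 ≤ |inner ℝ a b| ^ 2 := sq_nonneg _
  simp only [swapTestProb, Fintype.sum_bool, Bool.true_eq_false, if_false, if_true, mul_zero,
    Real.exp_zero, mul_one]
  set p := |inner ℝ a b| ^ 2
  have hls : |l * s| ≤ 1 := by rw [abs_mul, hs, mul_one, abs_of_nonneg hl₀]; exact hl₁
  have h2 := (abs_le.1 (Real.abs_exp_sub_one_sub_id_le hls)).2
  have h3 : (l * s) ^ 2 = l ^ 2 := by rw [mul_pow, ← sq_abs s, hs]; ring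
  rw [h3] at h2
  have h4 := mul_le_mul_of_nonneg_left (sub_le_iff_le_add.1 h2)
    (show 0 ≤ 1 / 2 + p / 2 by linarith)
  have h5 := Real.add_one_le_exp (l * s * (1 / 2 + p / 2) + l ^ 2)
  nlinarith [mul_le_mul_of_nonneg_right (show 1 / 2 + p / 2 ≤ 1 by linarith) (sq_nonneg l)]

theorem swapTestProb_nonneg {q : ℕ} {a b : QubitVector q} (ha : ‖a‖ = 1) (hb : ‖b‖ = 1)
    (z : Bool) : 0 ≤ swapTestProb a b z := by
  have h1 := abs_inner_sq_le_one ha hb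
  have h0 : 0 ≤ |inner ℝ a b| ^ 2 := sq_nonneg _
  unfold swapTestProb
  split_ifs <;> linarith

theorem exp_neg_two_le : Real.exp (-2) ≤ 1 / 3 := by
  rw [Real.exp_neg, one_div]
  exact inv_anti₀ (by norm_num) (by linarith [Real.add_one_le_exp (2 : ℝ)])

/-- The number of outcomes `0` in `r` swap tests is unlikely to deviate from its mean to the side
`s = ±1`. -/
theorem sum_filter_swapTestProb_le {q r : ℕ} {a b : QubitVector q} (ha : ‖a‖ = 1) (hb : ‖b‖ = 1)
    {s t γ : ℝ} (hs : |s| = 1) (hγ₀ : 0 < γ) (hγ₁ : γ ≤ 1) (hr : 128 ≤ r * γ ^ 2)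
    (ht : s * (1 / 2 + |inner ℝ a b| ^ 2 / 2) ≤ s * t - γ / 4) :
    ∑ z : Fin r → Bool with s * (r * t) ≤ s * zeroCount z, ∏ i, swapTestProb a b (z i) ≤
      1 / 3 := by
  have h := sum_filter_prod_le_exp (swapTestProb_nonneg ha hb) (l := γ / 8) (by positivity)
    (sum_swapTestProb_mul_exp_le ha hb hs (by positivity) (by linarith)) r (s * (r * t))
  simp only [← Finset.mul_sum] at h
  refine h.trans (le_trans (Real.exp_le_exp.2 ?_) exp_neg_two_le)
  -- With `l = γ / 8` the exponent is at most `r (l² - l γ / 4) = -r γ² / 64 ≤ -2`.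
  have h1 := mul_le_mul_of_nonneg_left ht (show 0 ≤ (r : ℝ) * (γ / 8) by positivity)
  nlinarith

/-- The protocol that a realization gives. -/
theorem IsRealization.exists_protocol [Nonempty X] [Nonempty Y] {k : ℕ}
    {α : X → EuclideanSpace ℝ (Fin k)}
    {β : Y → EuclideanSpace ℝ (Fin k)} {γ : ℝ} (h : IsRealization f α β γ) {q r : ℕ}
    (hq : k + 1 ≤ 2 ^ q) (hr : 128 ≤ r * γ ^ 2) :
    ∃ P : SwapTestProtocol X Y q r, P.IsRepeatedFingerprintingFor f ∧ P.Deterministic := by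
  classical
  obtain ⟨J⟩ := nonempty_linearIsometry_of_card_le (ι := Option (Fin k)) (κ := Fin q → Bool)
    (by simpa using hq)
  have hγ := h.pos
  have hγ1 := h.le_one
  set c : ℝ := (√2)⁻¹ with hc
  have hcc : c * c = 1 / 2 := by
    rw [hc, ← mul_inv, Real.mul_self_sqrt (by norm_num), one_div]
  -- The common coordinate makes the inner product nonnegative, so that squaring it in the swap test
  -- does not lose the sign of `⟨α x, β y⟩`.
  let a : X → QubitVector q := fun x => J (c • consCoord 1 (α x))
  let b : Y → QubitVector q := fun y => J (c • consCoord 1 (-β y))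
  have hnorm : ∀ v : EuclideanSpace ℝ (Fin k), ‖v‖ = 1 → ‖J (c • consCoord 1 v)‖ = 1 :=
    fun v hv => by
      have h2 : (0 : ℝ) < √2 := by positivity
      rw [J.norm_map, norm_smul, norm_consCoord, hv, hc, norm_inv, Real.norm_eq_abs,
        abs_of_pos h2, show (1 : ℝ) ^ 2 + 1 ^ 2 = 2 by norm_num, inv_mul_cancel₀ h2.ne']
  have ha : ∀ x, ‖a x‖ = 1 := fun x => hnorm _ (h.norm_left x)
  have hb : ∀ y, ‖b y‖ = 1 := fun y => hnorm _ (by rw [norm_neg, h.norm_right])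
  have hin : ∀ x y, inner ℝ (a x) (b y) = (1 - inner ℝ (α x) (β y)) / 2 := fun x y => by
    rw [J.inner_map_map, real_inner_smul_left, real_inner_smul_right, inner_consCoord,
      inner_neg_right, ← mul_assoc, hcc]
    ring
  have hle : ∀ x y, |inner ℝ (α x) (β y)| ≤ 1 := fun x y => by
    simpa [h.norm_left, h.norm_right] using abs_real_inner_le_norm (α x) (β y)
  have hemb : IsThresholdEmbedding f a b ((1 - γ) ^ 2 / 4) ((1 + γ) ^ 2 / 4) := by
    refine ⟨ha, hb, fun x y hf => ?_, fun x y hf => ?_⟩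
    · rw [hin, sq_abs]
      nlinarith [h.le_inner x y hf, (abs_le.1 (hle x y)).2]
    · rw [hin, sq_abs]
      nlinarith [h.inner_le x y hf]
  have hr1 : 1 ≤ r := by
    by_contra! h0
    have : r = 0 := by omega
    subst this
    norm_num at hr
  -- Midpoint of the outcome probabilities `1/2 + (1 ∓ γ)²/8` at the two thresholds; each lies `γ /
  -- 4` away.
  set t : ℝ := 1 / 2 + (1 + γ ^ 2) / 8 with ht
  let P : SwapTestProtocol X Y q r :=
    { alice := a
      bob := b
      norm_alice := ha
      norm_bob := hb
      one_le_copies := hr1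
      referee := fun z => if r * t ≤ zeroCount z then 1 else 0
      referee_mem := fun z => by split_ifs <;> simp }
  have hP : ∀ x y, P.outputOneProb x y =
      ∑ z : Fin r → Bool with r * t ≤ zeroCount z, ∏ i, swapTestProb (a x) (b y) (z i) :=
    fun x y => by
      simp only [SwapTestProtocol.outputOneProb, P, mul_ite, mul_one, mul_zero, Finset.sum_filter]
  refine ⟨P, ⟨⟨_, _, ?_, hemb⟩, fun x y hf => ?_, fun x y hf => ?_⟩, fun z => ?_⟩
  · nlinarith
  · rw [hP]
    have h1 := sum_filter_swapTestProb_le (r := r) (ha x) (hb y) (s := 1) (t := t) (by simp) hγ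
      hγ1 hr (by linarith [hemb.inner_sq_le x y hf])
    simpa only [one_mul] using h1
  · rw [hP]
    have h1 := sum_filter_swapTestProb_le (r := r) (ha x) (hb y) (s := -1) (t := t) (by simp) hγ
      hγ1 hr (by linarith [hemb.le_inner_sq x y hf])
    have htot : ∑ z : Fin r → Bool, ∏ i, swapTestProb (a x) (b y) (z i) = 1 := by
      rw [← Fintype.sum_pow, sum_swapTestProb, one_pow]
    rw [← Finset.sum_filter_add_sum_filter_not _ fun z : Fin r → Bool => r * t ≤ zeroCount z]
      at htot
    have h2 : ∑ z : Fin r → Bool with ¬ r * t ≤ zeroCount z,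
        ∏ i, swapTestProb (a x) (b y) (z i) ≤
        ∑ z : Fin r → Bool with -1 * (r * t) ≤ -1 * zeroCount z,
          ∏ i, swapTestProb (a x) (b y) (z i) := by
      refine Finset.sum_le_sum_of_subset_of_nonneg (fun z hz => ?_) fun z _ _ =>
        Finset.prod_nonneg fun i _ => swapTestProb_nonneg (ha x) (hb y) _
      simp only [Finset.mem_filter, Finset.mem_univ, true_and, not_le] at hz ⊢
      linarith
    linarith
  · by_cases hz : r * t ≤ zeroCount z
    · exact .inr (if_pos hz)
    · exact .inl (if_neg hz)

theorem exists_protocol_le [Fintype X] [Fintype Y] [Nonempty X] [Nonempty Y] {n : ℕ} (hn : 2 ≤ n)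
    (hX : Fintype.card X ≤ 2 ^ n) (hY : Fintype.card Y ≤ 2 ^ n) (f : X → Y → Bool) :
    ∃ (q r : ℕ) (P : SwapTestProtocol X Y q r),
      P.IsRepeatedFingerprintingFor f ∧ P.Deterministic ∧
      (r : ℝ) ≤ 2000 / maxMargin f ^ 2 ∧
      (q : ℝ) ≤ 2000 * Real.logb 2 ((n : ℝ) / maxMargin f) := by
  obtain ⟨d, α, β, h⟩ := (isGreatest_maxMargin f).1
  have hγ1 := h.le_one
  have hγ := h.pos
  set γ := maxMargin f
  have hn' : (2 : ℝ) ≤ n := by exact_mod_cast hn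
  have hγ2 : 1 ≤ 1 / γ ^ 2 := by
    rw [one_le_div (by positivity)]
    exact pow_le_one₀ hγ.le hγ1
  obtain ⟨α', β', h'⟩ := h.exists_fin (k := ⌈4096 * (2 * n + 4) / γ ^ 2⌉₊) hX hY (by
    have := Nat.le_ceil (4096 * (2 * n + 4) / γ ^ 2)
    rwa [div_le_iff₀ (by positivity)] at this)
  have hk := Nat.ceil_lt_add_one (show 0 ≤ 4096 * (2 * n + 4) / γ ^ 2 by positivity)
  set k := ⌈4096 * (2 * n + 4) / γ ^ 2⌉₊
  set B : ℝ := n / γ with hB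
  have hB2 : 2 ≤ B := by
    rw [hB, le_div_iff₀ hγ]
    linarith
  -- Since `n ≥ 2` and `γ ≤ 1`, `B ≥ 2`, so the constant `2^15` is absorbed into `B ^ 15`.
  have hkB : (k : ℝ) + 1 ≤ B ^ 17 := by
    have h1 : 4096 * (2 * n + 4) / γ ^ 2 ≤ 8192 * B ^ 2 := by
      rw [hB, div_pow, ← mul_div_assoc]
      refine div_le_div_of_nonneg_right ?_ (by positivity)
      nlinarith
    have h2 : (2 : ℝ) ^ 15 ≤ B ^ 15 := pow_le_pow_left₀ (by norm_num) hB2 15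
    have h3 : (2 : ℝ) ^ 2 ≤ B ^ 2 := pow_le_pow_left₀ (by norm_num) hB2 2
    have h4 : B ^ 17 = B ^ 15 * B ^ 2 := by ring
    have h5 := mul_le_mul_of_nonneg_right h2 (sq_nonneg B)
    rw [h4]
    linarith
  have hlog : 1 ≤ Real.logb 2 B := by
    rw [Real.le_logb_iff_rpow_le (by norm_num) (by linarith)]
    simpa using hB2
  set q := ⌈17 * Real.logb 2 B⌉₊ with hq
  have hq2 : k + 1 ≤ 2 ^ q := by
    have h1 : B ^ 17 ≤ (2 : ℝ) ^ q := by
      rw [← Real.rpow_natCast 2 q, ← Real.logb_le_iff_le_rpow (by norm_num) (by positivity),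
        Real.logb_pow]
      exact_mod_cast Nat.le_ceil (17 * Real.logb 2 B)
    exact_mod_cast hkB.trans h1
  -- `1152 = 9 * 128`, because the reduced realization has margin `γ / 3`.
  have hr := Nat.le_ceil (1152 / γ ^ 2)
  have hr' := Nat.ceil_lt_add_one (show 0 ≤ 1152 / γ ^ 2 by positivity)
  rw [div_le_iff₀ (by positivity)] at hr
  obtain ⟨P, hP, hdet⟩ := h'.exists_protocol (q := q) (r := ⌈1152 / γ ^ 2⌉₊) hq2 (by
    rw [div_pow]
    linarith)
  refine ⟨q, _, P, hP, hdet, ?_, ?_⟩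
  · have e : 2000 / γ ^ 2 = 1152 / γ ^ 2 + 848 * (1 / γ ^ 2) := by ring
    linarith
  · have := Nat.ceil_lt_add_one (show 0 ≤ 17 * Real.logb 2 B by positivity)
    linarith

end UpperBound

theorem mainTheorem3 :
    ∃ C c : ℝ, 0 < C ∧ 0 < c ∧
      ∀ (X Y : Type*) [Fintype X] [Fintype Y] [Nonempty X] [Nonempty Y]
        (n : ℕ) (_ : 2 ≤ n) (_ : Fintype.card X ≤ 2 ^ n) (_ : Fintype.card Y ≤ 2 ^ n)
        (f : X → Y → Bool),
        IsGreatest (marginSet f) (maxMargin f) ∧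
        (∃ (q r : ℕ) (P : SwapTestProtocol X Y q r),
          P.IsRepeatedFingerprintingFor f ∧ P.Deterministic ∧
          (r : ℝ) ≤ C / maxMargin f ^ 2 ∧
          (q : ℝ) ≤ C * Real.logb 2 ((n : ℝ) / maxMargin f)) ∧
        (∀ (q r : ℕ) (P : SwapTestProtocol X Y q r),
          P.IsRepeatedFingerprintingFor f → c / maxMargin f ^ 2 ≤ (r : ℝ)) := by
  refine ⟨2000, 1 / 1024, by norm_num, by norm_num, ?_⟩
  intro X Y _ _ _ _ n hn hX hY f
  exact ⟨isGreatest_maxMargin f, exists_protocol_le hn hX hY f,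
    fun q r P hP => le_copies_of_isRepeatedFingerprintingFor hP⟩
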